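/- Let $s\ge 1$ be an integer, $N$ a natural number, and consider $3N$ spins with spin quantum number $s$, labelled by $\mu=(i,\delta)$ with $i\in\{1,\dots,N\}$ (the trimer index) and $\delta\in\{0,1,2\}$, with Hilbert space $\mathcal H=\bigotimes_{\mu}\mathbb C^{2s+1}$ and spin operators $\mathbf s_\mu=(s_\mu^{(1)},s_\mu^{(2)},s_\mu^{(3)})$. Let $\mathbb J=(J_{\mu\nu})$ be a real symmetric $3N\times 3N$ matrix with $J_{\mu\mu}=0$ for all $\mu$, and let $$H(\mathbb J)=\sum_{\mu,\nu}J_{\mu\nu}\,\mathbf s_\mu\cdot\mathbf s_\nu .$$ For each $i$ let $[i0,i1,i2]$ be a normalized ground state (that is, a unit vector minimizing the energy) of the antiferromagnetic trimer Hamiltonian $\lambda_i\sum_{\delta,\epsilon=0}^{2}\mathbf s_{i\delta}\cdot\mathbf s_{i\epsilon}$, $\lambda_i>0$, and let $\Phi=\bigotimes_{i=1}^N[i0,i1,i2]$. Then $\Phi$ is an eigenstate of $H(\mathbb J)$ if and only if for all $1\le i<j\le N$ $$\begin{aligned} J_{i0,j0}+J_{i1,j1}&=J_{i0,j1}+J_{i1,j0},\\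 J_{i0,j0}+J_{i1,j2}&=J_{i0,j2}+J_{i1,j0},\\ J_{i0,j0}+J_{i2,j1}&=J_{i0,j1}+J_{i2,j0},\\ J_{i0,j0}+J_{i2,j2}&=J_{i0,j2}+J_{i2,j0}. \end{aligned}$$ Moreover, for all $i<j$ these four equations are equivalent to the statement that the $3\times3$ matrix $\breve J_{ij}=(J_{i\epsilon,j\delta})_{\epsilon,\delta=0,1,2}$ is orthogonal, with respect to the inner product $\langle A,B\rangle=\operatorname{Tr}(A^{\top}B)$, to the space of all real $3\times3$ matrices with vanishing row and column sums. -/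

import Mathlib

namespace SpinTrimer

noncomputable section

/-- The magnetic quantum number `m ∈ {-s, …, s}` belonging to the basis index `k ∈ {0, …, 2s}`. -/
def magneticNumber (s : ℕ) (k : Fin (2 * s + 1)) : ℝ := (k : ℝ) - (s : ℝ)

/-- The raising operator for one spin `s`, in the eigenbasis `|m⟩` of `s⁽³⁾`:
`s⁺ |m⟩ = √(s (s + 1) - m (m + 1)) |m + 1⟩`. -/
def spinRaising (s : ℕ) : Matrix (Fin (2 * s + 1)) (Fin (2 * s + 1)) ℂ :=
  Matrix.of fun a b =>
    if (a : ℕ) = (b : ℕ) + 1 then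
      ((Real.sqrt ((s : ℝ) * ((s : ℝ) + 1) -
        magneticNumber s b * (magneticNumber s b + 1)) : ℝ) : ℂ)
    else 0

/-- The lowering operator, the adjoint of the raising operator. -/
def spinLowering (s : ℕ) : Matrix (Fin (2 * s + 1)) (Fin (2 * s + 1)) ℂ :=
  (spinRaising s).conjTranspose

/-- The three spin matrices `s⁽¹⁾, s⁽²⁾, s⁽³⁾` (in units of `ħ`) for the spin quantum number `s`. -/
def spinMatrix (s : ℕ) : Fin 3 → Matrix (Fin (2 * s + 1)) (Fin (2 * s + 1)) ℂ :=
  ![(1 / 2 : ℂ) • (spinRaising s + spinLowering s),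
    (1 / (2 * Complex.I) : ℂ) • (spinRaising s - spinLowering s),
    Matrix.diagonal fun k => ((magneticNumber s k : ℝ) : ℂ)]

/-- The Hilbert space `⨂_{μ ∈ ι} ℂ^{2s+1}` of a system of spins with sites `ι`. It is written in
its orthonormal product basis `|(m_μ)_μ⟩`, that is, a state is the family of its coefficients. -/
abbrev SpinState (ι : Type) [Fintype ι] (s : ℕ) : Type :=
  EuclideanSpace ℂ (ι → Fin (2 * s + 1))

/-- The operator `A` acting at the site `μ`, and the identity at all other sites. -/
def siteOp {ι : Type} [Fintype ι] [DecidableEq ι] {s : ℕ} (μ : ι)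
    (A : Matrix (Fin (2 * s + 1)) (Fin (2 * s + 1)) ℂ) : Module.End ℂ (SpinState ι s) where
  toFun ψ := WithLp.toLp 2 fun m => ∑ k, A (m μ) k * ψ (Function.update m μ k)
  map_add' ψ χ := by
    ext m
    simp [mul_add, Finset.sum_add_distrib]
  map_smul' c ψ := by
    ext m
    simp [Finset.mul_sum, mul_left_comm]

/-- The operator `𝐬_μ · 𝐬_ν = ∑_a s_μ⁽ᵃ⁾ s_ν⁽ᵃ⁾`. -/
def spinDot {ι : Type} [Fintype ι] [DecidableEq ι] (s : ℕ) (μ ν : ι) :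
    Module.End ℂ (SpinState ι s) :=
  ∑ a : Fin 3, siteOp μ (spinMatrix s a) * siteOp ν (spinMatrix s a)

/-- The Heisenberg Hamiltonian `H(J) = ∑_{μ ν} J_{μ ν} 𝐬_μ · 𝐬_ν`. -/
def heisenberg {ι : Type} [Fintype ι] [DecidableEq ι] (s : ℕ) (J : Matrix ι ι ℝ) :
    Module.End ℂ (SpinState ι s) :=
  ∑ μ, ∑ ν, ((J μ ν : ℝ) : ℂ) • spinDot s μ ν

/-- `φ` is a (normalized) ground state of `H`: a unit vector that minimizes the energy
`⟨ψ, H ψ⟩` among all unit vectors. -/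
def IsGroundState {E : Type} [NormedAddCommGroup E] [InnerProductSpace ℂ E]
    (H : Module.End ℂ E) (φ : E) : Prop :=
  ‖φ‖ = 1 ∧ ∀ ψ : E, ‖ψ‖ = 1 → (inner ℂ φ (H φ)).re ≤ (inner ℂ ψ (H ψ)).re

/-- The Hamiltonian `H₀ = l ∑_{δ ε} 𝐬_δ · 𝐬_ε` of a single trimer with uniform coupling `l`. -/
def trimerHamiltonian (s : ℕ) (l : ℝ) : Module.End ℂ (SpinState (Fin 3) s) :=
  heisenberg s (Matrix.of fun _ _ => l)

/-- The product `⨂_i φ_i` of states of `N` trimers; the spins are labelled by `(i, δ)`. -/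
def trimerProduct {N s : ℕ} (φ : Fin N → SpinState (Fin 3) s) :
    SpinState (Fin N × Fin 3) s :=
  WithLp.toLp 2 fun m => ∏ i, φ i fun δ => m (i, δ)

/-- `ψ` is an eigenstate of `H`: a nonzero vector with `H ψ = E ψ` for some `E`. -/
def IsEigenstate {E : Type} [NormedAddCommGroup E] [InnerProductSpace ℂ E]
    (H : Module.End ℂ E) (ψ : E) : Prop :=
  ∃ e : ℂ, Module.End.HasEigenvector H e ψ

/-- The `3 × 3` matrix of the couplings between the trimers `i` and `j`. -/
def interBlock {N : ℕ} (J : Matrix (Fin N × Fin 3) (Fin N × Fin 3) ℝ) (i j : Fin N) :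
    Matrix (Fin 3) (Fin 3) ℝ :=
  Matrix.of fun ε δ => J (i, ε) (j, δ)

/-- The four balance equations for the couplings between the trimers `i` and `j`. -/
def Balanced {N : ℕ} (J : Matrix (Fin N × Fin 3) (Fin N × Fin 3) ℝ) (i j : Fin N) : Prop :=
  J (i, 0) (j, 0) + J (i, 1) (j, 1) = J (i, 0) (j, 1) + J (i, 1) (j, 0) ∧
  J (i, 0) (j, 0) + J (i, 1) (j, 2) = J (i, 0) (j, 2) + J (i, 1) (j, 0) ∧
  J (i, 0) (j, 0) + J (i, 2) (j, 1) = J (i, 0) (j, 1) + J (i, 2) (j, 0) ∧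
  J (i, 0) (j, 0) + J (i, 2) (j, 2) = J (i, 0) (j, 2) + J (i, 2) (j, 0)

/-- The space of the real `3 × 3` matrices with vanishing row and column sums. -/
def zeroSumMatrices : Submodule ℝ (Matrix (Fin 3) (Fin 3) ℝ) where
  carrier := {D | (∀ a, ∑ b, D a b = 0) ∧ ∀ b, ∑ a, D a b = 0}
  zero_mem' := by simp
  add_mem' := by
    rintro A B ⟨hA, hA'⟩ ⟨hB, hB'⟩
    exact ⟨fun a => by simp [Finset.sum_add_distrib, hA, hB],
      fun b => by simp [Finset.sum_add_distrib, hA', hB']⟩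
  smul_mem' := by
    rintro c A ⟨hA, hA'⟩
    exact ⟨fun a => by simp [← Finset.mul_sum, hA], fun b => by simp [← Finset.mul_sum, hA']⟩

end

end SpinTrimer

namespace SpinTrimer

open Finset

/-! ### Algebra and adjoints of single-site operators. -/

section SiteOp

variable {ι : Type} [Fintype ι] [DecidableEq ι] {s : ℕ}

/-! The trimer Hamiltonian is `l` times the sum of the squares of the total spin components, so its
energy is nonnegative and vanishes exactly on singlets. Three integer spins do possess a singlet:
raising maps the weight-zero space into the smaller weight-one space (`exists_singlet`). Hence every
trimer ground state is a singlet (`IsGroundState.isSinglet`), and only this property and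
nonvanishing are used afterwards.

On a product of singlets the couplings inside a trimer act as scalars (`IsSinglet.spinDot_of_ne`).
The balance equations say that the block between two trimers has the form `α δ + β ε`; each summand
couples a spin to the total spin of the other trimer, which annihilates the state
(`couplingTerm_eq_zero_of_balanced`).

Conversely, read the eigenvalue equation at a basis state occurring in the product. A spin flip in
one of two different trimers destroys its zero weight, so only the `s⁽³⁾ s⁽³⁾` terms survive, and
the classical inter-trimer energy is constant on the support (`exists_interForm_eq`). Varying two
trimers independently and taking a second difference isolates their block (`sum_coupling_eq_zero`).
Singlet coefficients are nonzero at weight-zero states with one maximal spin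
(`IsSinglet.ne_zero_of_top`); this gives enough differences to span the zero-sum vectors, hence all
four equations. -/

theorem siteOp_apply (μ : ι) (A : Matrix (Fin (2 * s + 1)) (Fin (2 * s + 1)) ℂ)
    (ψ : SpinState ι s) (m : ι → Fin (2 * s + 1)) :
    siteOp μ A ψ m = ∑ k, A (m μ) k * ψ (Function.update m μ k) := rfl

theorem siteOp_add (μ : ι) (A B : Matrix (Fin (2 * s + 1)) (Fin (2 * s + 1)) ℂ) :
    siteOp (ι := ι) μ (A + B) = siteOp μ A + siteOp μ B := by
  ext ψ m
  simp [siteOp_apply, add_mul, sum_add_distrib]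

theorem siteOp_smul (μ : ι) (c : ℂ) (A : Matrix (Fin (2 * s + 1)) (Fin (2 * s + 1)) ℂ) :
    siteOp (ι := ι) μ (c • A) = c • siteOp μ A := by
  ext ψ m
  simp [siteOp_apply, mul_sum, mul_assoc]

theorem siteOp_mul (μ : ι) (A B : Matrix (Fin (2 * s + 1)) (Fin (2 * s + 1)) ℂ) :
    siteOp (ι := ι) μ (A * B) = siteOp μ A * siteOp μ B := by
  ext ψ m
  simp only [Module.End.mul_apply, siteOp_apply, Matrix.mul_apply, Function.update_self,
    Function.update_idem, sum_mul, mul_sum]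
  rw [sum_comm]
  simp only [mul_assoc]

theorem siteOp_one (μ : ι) :
    siteOp (ι := ι) μ (1 : Matrix (Fin (2 * s + 1)) (Fin (2 * s + 1)) ℂ) = 1 := by
  ext ψ m
  simp [siteOp_apply, Matrix.one_apply]

theorem siteOp_comm {μ ν : ι} (h : μ ≠ ν)
    (A B : Matrix (Fin (2 * s + 1)) (Fin (2 * s + 1)) ℂ) :
    siteOp (ι := ι) μ A * siteOp ν B = siteOp ν B * siteOp μ A := by
  ext ψ m
  simp only [Module.End.mul_apply, siteOp_apply, mul_sum, Function.update_of_ne h,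
    Function.update_of_ne h.symm]
  rw [sum_comm]
  refine sum_congr rfl fun k _ => sum_congr rfl fun l _ => ?_
  rw [Function.update_comm h, mul_left_comm]

theorem siteOp_diagonal_apply (μ : ι) (d : Fin (2 * s + 1) → ℂ)
    (ψ : SpinState ι s) (m : ι → Fin (2 * s + 1)) :
    siteOp μ (Matrix.diagonal d) ψ m = d (m μ) * ψ m := by
  simp [siteOp_apply, Matrix.diagonal_apply]

theorem inner_siteOp_left (μ : ι) (A : Matrix (Fin (2 * s + 1)) (Fin (2 * s + 1)) ℂ)
    (ψ χ : SpinState ι s) :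
    inner ℂ (siteOp μ A ψ) χ = inner ℂ ψ (siteOp μ A.conjTranspose χ) := by
  simp only [PiLp.inner_apply, RCLike.inner_apply, siteOp_apply, map_sum, map_mul, mul_sum,
    sum_mul, ← Fintype.sum_prod_type']
  -- The involution exchanges the entry at `μ` with the summation index.
  refine Fintype.sum_bijective
    (fun x : (ι → Fin (2 * s + 1)) × Fin (2 * s + 1) => (Function.update x.1 μ x.2, x.1 μ))
    (Function.Involutive.bijective fun x => by simp) _ _ fun x => ?_
  simp only [Function.update_self, Function.update_idem, Function.update_eq_self,
    Matrix.conjTranspose_apply, RCLike.star_def]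
  ring

end SiteOp

/-! ### Ladder identities and the Casimir of one spin. -/

section SpinMatrices

variable (s : ℕ)

theorem spinLowering_apply (a b : Fin (2 * s + 1)) :
    spinLowering s a b = if (b : ℕ) = (a : ℕ) + 1 then
      ((Real.sqrt ((s : ℝ) * ((s : ℝ) + 1) -
        magneticNumber s a * (magneticNumber s a + 1)) : ℝ) : ℂ) else 0 := by
  simp only [spinLowering, spinRaising, Matrix.conjTranspose_apply, Matrix.of_apply]
  split_ifs <;> simp

theorem ladder_radicand (k : Fin (2 * s + 1)) :
    (s : ℝ) * ((s : ℝ) + 1) - magneticNumber s k * (magneticNumber s k + 1) =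
      (2 * s - k) * (k + 1) := by
  simp only [magneticNumber]; ring

theorem ladder_radicand_nonneg (k : Fin (2 * s + 1)) :
    0 ≤ (s : ℝ) * ((s : ℝ) + 1) - magneticNumber s k * (magneticNumber s k + 1) := by
  rw [ladder_radicand]
  have : (k : ℝ) ≤ 2 * s := by exact_mod_cast Nat.lt_succ_iff.mp k.isLt
  exact mul_nonneg (by linarith) (by positivity)

theorem ladder_coeff_ne_zero {k : Fin (2 * s + 1)} (hk : (k : ℕ) < 2 * s) :
    ((Real.sqrt ((s : ℝ) * ((s : ℝ) + 1) -
        magneticNumber s k * (magneticNumber s k + 1)) : ℝ) : ℂ) ≠ 0 := by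
  rw [ladder_radicand]
  have : (k : ℝ) < 2 * s := by exact_mod_cast hk
  have h2 : (0 : ℝ) < (2 * s - k) * (k + 1) := mul_pos (by linarith) (by positivity)
  exact Complex.ofReal_ne_zero.mpr (Real.sqrt_pos.mpr h2).ne'

theorem lowering_mul_raising : spinLowering s * spinRaising s =
    Matrix.diagonal fun k => (((s : ℝ) * ((s : ℝ) + 1) -
        magneticNumber s k * (magneticNumber s k + 1) : ℝ) : ℂ) := by
  ext a b
  simp only [Matrix.mul_apply, spinLowering_apply, spinRaising, Matrix.of_apply,
    Matrix.diagonal_apply]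
  split_ifs with hab
  · subst hab
    by_cases ha : (a : ℕ) < 2 * s
    · rw [Fintype.sum_eq_single (⟨a + 1, by omega⟩ : Fin (2 * s + 1))]
      · simp only [if_true, ← Complex.ofReal_mul]
        rw [Real.mul_self_sqrt (ladder_radicand_nonneg s a)]
      · intro c hc
        rw [if_neg (fun h => hc (Fin.ext h)), zero_mul]
    -- At the top state the sum is empty and the radicand vanishes too.
    · have ha' : (a : ℕ) = 2 * s := by omega
      rw [ladder_radicand, ha', sum_eq_zero]
      · simp
      · intro c _
        rw [if_neg (by omega), zero_mul]
  · refine sum_eq_zero fun c _ => ?_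
    split_ifs <;> first | (exfalso; apply hab; ext; omega) | simp

theorem raising_mul_lowering : spinRaising s * spinLowering s =
    Matrix.diagonal fun k => (((s : ℝ) * ((s : ℝ) + 1) -
        magneticNumber s k * (magneticNumber s k - 1) : ℝ) : ℂ) := by
  ext a b
  simp only [Matrix.mul_apply, spinLowering_apply, spinRaising, Matrix.of_apply,
    Matrix.diagonal_apply]
  split_ifs with hab
  · subst hab
    by_cases ha : 0 < (a : ℕ)
    · rw [Fintype.sum_eq_single (⟨a - 1, by omega⟩ : Fin (2 * s + 1))]
      · have h1 : (a : ℕ) = (a : ℕ) - 1 + 1 := by omega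
        have h2 : magneticNumber s ⟨a - 1, by omega⟩ = magneticNumber s a - 1 := by
          simp only [magneticNumber]
          rw [Nat.cast_sub ha]; push_cast; ring
        rw [if_pos h1, ← Complex.ofReal_mul, Real.mul_self_sqrt (ladder_radicand_nonneg s _), h2]
        congr 1; ring
      · intro c hc
        rw [if_neg (fun h => hc (Fin.ext (by simp; omega))), zero_mul]
    · have ha' : (a : ℕ) = 0 := by omega
      rw [sum_eq_zero]
      · simp [magneticNumber, ha']
        ring
      · intro c _
        rw [if_neg (by omega), zero_mul]
  · refine sum_eq_zero fun c _ => ?_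
    split_ifs <;> first | (exfalso; apply hab; ext; omega) | simp

theorem raising_lowering_commutator :
    spinRaising s * spinLowering s = spinLowering s * spinRaising s +
      (2 : ℂ) • spinMatrix s 2 := by
  rw [raising_mul_lowering, lowering_mul_raising]
  simp only [spinMatrix, Matrix.cons_val]
  rw [← Matrix.diagonal_smul, Matrix.diagonal_add]
  congr 1; ext k
  simp only [Pi.smul_apply, smul_eq_mul]
  push_cast; ring

theorem spinRaising_eq : spinRaising s = spinMatrix s 0 + Complex.I • spinMatrix s 1 := by
  simp only [spinMatrix, Matrix.cons_val, smul_smul]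
  rw [show Complex.I * (1 / (2 * Complex.I)) = (1 / 2 : ℂ) by field_simp]
  module

theorem spinLowering_eq : spinLowering s = spinMatrix s 0 - Complex.I • spinMatrix s 1 := by
  simp only [spinMatrix, Matrix.cons_val, smul_smul]
  rw [show Complex.I * (1 / (2 * Complex.I)) = (1 / 2 : ℂ) by field_simp]
  module

theorem spinMatrix_conjTranspose (a : Fin 3) :
    (spinMatrix s a).conjTranspose = spinMatrix s a := by
  fin_cases a
  · simp [spinMatrix, spinLowering, add_comm]
  · simp only [spinMatrix, spinLowering, Fin.mk_one, Matrix.cons_val, Matrix.conjTranspose_smul,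
      Matrix.conjTranspose_sub, Matrix.conjTranspose_conjTranspose]
    rw [← neg_sub, smul_neg, ← neg_smul]
    congr 1
    simp
  · simp [spinMatrix, Matrix.diagonal_conjTranspose, Pi.star_def]

/-- The squares of the first two components add up to half of `s⁺s⁻ + s⁻s⁺`, in which the terms
linear in `m` cancel. -/
theorem spinMatrix_casimir :
    ∑ a, spinMatrix s a * spinMatrix s a = ((s : ℂ) * (s + 1)) • 1 := by
  have h : ∑ a, spinMatrix s a * spinMatrix s a =
      (1 / 2 : ℂ) • (spinRaising s * spinLowering s + spinLowering s * spinRaising s) +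
        spinMatrix s 2 * spinMatrix s 2 := by
    rw [Fin.sum_univ_three]
    congr 1
    simp only [spinMatrix, Matrix.cons_val, smul_mul_smul_comm]
    rw [show (1 / (2 * Complex.I) * (1 / (2 * Complex.I)) : ℂ) = -(1 / 4) by
      field_simp; simp; norm_num]
    simp only [mul_add, add_mul, mul_sub, sub_mul]
    module
  rw [h, raising_mul_lowering, lowering_mul_raising]
  simp only [spinMatrix, Matrix.cons_val]
  rw [Matrix.diagonal_add, ← Matrix.diagonal_smul, Matrix.diagonal_mul_diagonal,
    Matrix.diagonal_add, ← Matrix.diagonal_one, ← Matrix.diagonal_smul]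
  congr 1; ext k
  simp only [Pi.smul_apply, smul_eq_mul]
  push_cast; ring

theorem spinMatrix_apply_self (a : Fin 3) (k : Fin (2 * s + 1)) :
    spinMatrix s a k k = if a = 2 then (magneticNumber s k : ℂ) else 0 := by
  fin_cases a <;> simp [spinMatrix, spinLowering_apply, spinRaising]

end SpinMatrices

/-! ### Ladder operators on coefficients; collective operators. -/

section Ladder

variable {ι : Type} [Fintype ι] [DecidableEq ι] {s : ℕ}

theorem siteOp_raising_apply (μ : ι) (ψ : SpinState ι s) (m : ι → Fin (2 * s + 1))
    (k : Fin (2 * s + 1)) (hk : (m μ : ℕ) = k + 1) :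
    siteOp μ (spinRaising s) ψ m = ((Real.sqrt ((s : ℝ) * ((s : ℝ) + 1) -
        magneticNumber s k * (magneticNumber s k + 1)) : ℝ) : ℂ) *
      ψ (Function.update m μ k) := by
  rw [siteOp_apply, Fintype.sum_eq_single k]
  · simp [spinRaising, hk]
  · intro c hc
    simp only [spinRaising, Matrix.of_apply]
    rw [if_neg (fun h => hc (Fin.ext (by omega))), zero_mul]

theorem siteOp_lowering_apply (μ : ι) (ψ : SpinState ι s) (m : ι → Fin (2 * s + 1))
    (k : Fin (2 * s + 1)) (hk : (k : ℕ) = m μ + 1) :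
    siteOp μ (spinLowering s) ψ m = ((Real.sqrt ((s : ℝ) * ((s : ℝ) + 1) -
        magneticNumber s (m μ) * (magneticNumber s (m μ) + 1)) : ℝ) : ℂ) *
      ψ (Function.update m μ k) := by
  rw [siteOp_apply, Fintype.sum_eq_single k]
  · simp [spinLowering_apply, hk]
  · intro c hc
    rw [spinLowering_apply, if_neg (fun h => hc (Fin.ext (by omega))), zero_mul]

theorem siteOp_lowering_apply_top (μ : ι) (ψ : SpinState ι s) (m : ι → Fin (2 * s + 1))
    (hm : (m μ : ℕ) = 2 * s) : siteOp μ (spinLowering s) ψ m = 0 := by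
  rw [siteOp_apply]
  refine sum_eq_zero fun c _ => ?_
  rw [spinLowering_apply, if_neg (by omega), zero_mul]

/-- The collective operator `∑_μ A_μ`. -/
noncomputable def totalOp (ι : Type) [Fintype ι] [DecidableEq ι] {s : ℕ}
    (A : Matrix (Fin (2 * s + 1)) (Fin (2 * s + 1)) ℂ) : Module.End ℂ (SpinState ι s) :=
  ∑ μ, siteOp μ A

theorem totalOp_add (A B : Matrix (Fin (2 * s + 1)) (Fin (2 * s + 1)) ℂ) :
    totalOp ι (A + B) = totalOp ι A + totalOp ι B := by
  simp [totalOp, siteOp_add, sum_add_distrib]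

theorem totalOp_smul (c : ℂ) (A : Matrix (Fin (2 * s + 1)) (Fin (2 * s + 1)) ℂ) :
    totalOp ι (c • A) = c • totalOp ι A := by
  simp [totalOp, siteOp_smul, smul_sum]

theorem totalOp_apply (A : Matrix (Fin (2 * s + 1)) (Fin (2 * s + 1)) ℂ)
    (ψ : SpinState ι s) (m : ι → Fin (2 * s + 1)) :
    totalOp ι A ψ m = ∑ μ, siteOp μ A ψ m := by
  simp [totalOp]

theorem inner_totalOp_left (A : Matrix (Fin (2 * s + 1)) (Fin (2 * s + 1)) ℂ)
    (ψ χ : SpinState ι s) :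
    inner ℂ (totalOp ι A ψ) χ = inner ℂ ψ (totalOp ι A.conjTranspose χ) := by
  simp only [totalOp, LinearMap.sum_apply, sum_inner, inner_sum, inner_siteOp_left]

/-- Collective operators obey the commutation relations of the single-site matrices. -/
theorem totalOp_mul_eq {A B C : Matrix (Fin (2 * s + 1)) (Fin (2 * s + 1)) ℂ}
    (h : A * B = B * A + C) :
    totalOp ι A * totalOp ι B = totalOp ι B * totalOp ι A + totalOp ι C := by
  simp only [totalOp, sum_mul_sum]
  rw [sum_comm (f := fun μ ν => siteOp μ B * siteOp ν A), ← sum_add_distrib]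
  refine sum_congr rfl fun μ _ => ?_
  have hμ : siteOp μ C = ∑ ν, if ν = μ then siteOp (ι := ι) μ C else 0 := by simp
  rw [hμ, ← sum_add_distrib]
  refine sum_congr rfl fun ν _ => ?_
  split_ifs with e
  · subst e
    rw [← siteOp_mul, ← siteOp_mul, ← siteOp_add, h]
  · rw [add_zero, siteOp_comm (Ne.symm e)]

end Ladder

/-! ### Singlets, their existence for three spins, and trimer ground states. -/

section Singlet

variable {ι : Type} [Fintype ι] [DecidableEq ι] {s : ℕ}

/-- `φ` has total spin zero: it is annihilated by the three components of the total spin. -/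
def IsSinglet (φ : SpinState ι s) : Prop :=
  ∀ a, totalOp ι (spinMatrix s a) φ = 0

theorem totalOp_spinMatrix_two_apply (φ : SpinState ι s) (m : ι → Fin (2 * s + 1)) :
    totalOp ι (spinMatrix s 2) φ m = (∑ μ, (magneticNumber s (m μ) : ℂ)) * φ m := by
  rw [totalOp_apply, sum_mul]
  exact sum_congr rfl fun μ _ => siteOp_diagonal_apply μ _ φ m

theorem IsSinglet.raising {φ : SpinState ι s} (h : IsSinglet φ) :
    totalOp ι (spinRaising s) φ = 0 := by
  simp [spinRaising_eq, totalOp_add, totalOp_smul, h 0, h 1]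

theorem IsSinglet.lowering {φ : SpinState ι s} (h : IsSinglet φ) :
    totalOp ι (spinLowering s) φ = 0 := by
  rw [spinLowering_eq, sub_eq_add_neg, ← neg_smul, totalOp_add, totalOp_smul]
  simp [h 0, h 1]

theorem sum_magneticNumber {κ : Type} [Fintype κ] (m : κ → Fin (2 * s + 1)) :
    ∑ μ, (magneticNumber s (m μ) : ℂ) =
      ((∑ μ, (m μ : ℕ) : ℕ) : ℂ) - ((Fintype.card κ * s : ℕ) : ℂ) := by
  simp [magneticNumber]

/-- The third total spin component is diagonal; with indices shifted by `s` per site, weight zero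
means index sum `card ι * s`. -/
theorem IsSinglet.eq_zero_of_sum_ne {φ : SpinState ι s} (h : IsSinglet φ)
    {m : ι → Fin (2 * s + 1)} (hm : ∑ μ, (m μ : ℕ) ≠ Fintype.card ι * s) : φ m = 0 := by
  have h2 : totalOp ι (spinMatrix s 2) φ m = 0 := by simp [h 2]
  rw [totalOp_spinMatrix_two_apply, sum_magneticNumber] at h2
  refine (mul_eq_zero.mp h2).resolve_left (sub_ne_zero.mpr ?_)
  exact Nat.cast_injective.ne hm

/-- A vector of weight zero that is annihilated by the raising operator is a singlet. -/
theorem isSinglet_of_raising {φ : SpinState ι s}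
    (hw : ∀ m : ι → Fin (2 * s + 1), ∑ μ, (m μ : ℕ) ≠ Fintype.card ι * s → φ m = 0)
    (hr : totalOp ι (spinRaising s) φ = 0) : IsSinglet φ := by
  have h2 : totalOp ι (spinMatrix s 2) φ = 0 := by
    ext m
    rw [totalOp_spinMatrix_two_apply, sum_magneticNumber]
    by_cases hm : ∑ μ, (m μ : ℕ) = Fintype.card ι * s
    · simp [hm]
    · simp [hw m hm]
  -- With `S³φ = S⁺φ = 0`, `‖S⁻φ‖² = ⟨φ, S⁺S⁻φ⟩ = ⟨φ, (S⁻S⁺ + 2S³)φ⟩ = 0`.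
  have hl : totalOp ι (spinLowering s) φ = 0 := by
    have hc := congrArg (fun T => T φ) (totalOp_mul_eq (ι := ι) (raising_lowering_commutator s))
    simp only [Module.End.mul_apply, LinearMap.add_apply, totalOp_smul, LinearMap.smul_apply, h2,
      hr, map_zero, smul_zero, add_zero] at hc
    rw [← inner_self_eq_zero (𝕜 := ℂ), inner_totalOp_left]
    simp [spinLowering] at hc ⊢
    simp [hc]
  have e1 : totalOp ι (spinMatrix s 0) φ + Complex.I • totalOp ι (spinMatrix s 1) φ = 0 := by
    rw [← hr, spinRaising_eq, totalOp_add, totalOp_smul]; rfl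
  have e2 : totalOp ι (spinMatrix s 0) φ - Complex.I • totalOp ι (spinMatrix s 1) φ = 0 := by
    rw [← hl, spinLowering_eq, sub_eq_add_neg, sub_eq_add_neg, ← neg_smul, ← neg_smul, totalOp_add,
      totalOp_smul]; rfl
  have e0 : totalOp ι (spinMatrix s 0) φ = 0 := by
    have : (2 : ℂ) • totalOp ι (spinMatrix s 0) φ = 0 := by
      have e := congrArg₂ (· + ·) e1 e2
      rw [two_smul]
      simpa using e
    simpa using this
  intro a
  fin_cases a
  · exact e0
  · rw [e0, zero_add] at e1
    simpa using e1
  · exact h2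

/-- There are more weight-zero basis states of three spins than basis states of weight one. -/
theorem card_weight_one_lt_card_weight_zero (s : ℕ) :
    Fintype.card {m : Fin 3 → Fin (2 * s + 1) // ∑ δ, (m δ : ℕ) = 3 * s + 1} <
      Fintype.card {m : Fin 3 → Fin (2 * s + 1) // ∑ δ, (m δ : ℕ) = 3 * s} := by
  have hb : ∀ k : Fin (2 * s + 1), (k : ℕ) ≤ 2 * s := fun k => Nat.lt_succ_iff.mp k.isLt
  refine Fintype.card_lt_of_injective_of_notMem
    -- The injection lowers the first entry if it can, and sends `(0, b, c)` to `(2s, b - (s + 1),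
    -- 2s + 1 - b)`. A first entry `2s` occurs only in the second case, where the last entry is
    -- positive; so `(2s, s, 0)` is missed.
    (fun m => if h : (m.1 0 : ℕ) = 0 then
        ⟨![⟨2 * s, by omega⟩, ⟨m.1 1 - (s + 1), by have := hb (m.1 1); omega⟩,
          ⟨2 * s + 1 - m.1 1, by
            have := m.2; have := hb (m.1 2); rw [Fin.sum_univ_three] at *; omega⟩], by
          have := m.2; have := hb (m.1 1); have := hb (m.1 2)
          simp only [Fin.sum_univ_three, Matrix.cons_val] at *; omega⟩
      else ⟨![⟨m.1 0 - 1, by have := hb (m.1 0); omega⟩, m.1 1, m.1 2], by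
          have := m.2
          simp only [Fin.sum_univ_three, Matrix.cons_val] at *; omega⟩)
    (b := ⟨![⟨2 * s, by omega⟩, ⟨s, by omega⟩, ⟨0, by omega⟩], by
      simp only [Fin.sum_univ_three, Matrix.cons_val]; omega⟩) ?_ ?_
  · rintro ⟨m, hm⟩ ⟨n, hn⟩ h
    have h0 := hb (m 0); have h1 := hb (m 1); have h2 := hb (m 2)
    have k0 := hb (n 0); have k1 := hb (n 1); have k2 := hb (n 2)
    rw [Fin.sum_univ_three] at hm hn
    have key : (m 0 : ℕ) = n 0 ∧ (m 1 : ℕ) = n 1 ∧ (m 2 : ℕ) = n 2 := by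
      dsimp only at h
      split_ifs at h with u v v <;>
        (have e := congrArg Subtype.val h
         have e0 := congrArg Fin.val (congrFun e 0)
         have e1 := congrArg Fin.val (congrFun e 1)
         have e2 := congrArg Fin.val (congrFun e 2)
         simp only [Matrix.cons_val] at e0 e1 e2
         omega)
    ext δ
    fin_cases δ
    exacts [key.1, key.2.1, key.2.2]
  · rintro ⟨⟨m, hm⟩, h⟩
    have h0 := hb (m 0); have h1 := hb (m 1); have h2 := hb (m 2)
    rw [Fin.sum_univ_three] at hm
    dsimp only at h
    split_ifs at h with u <;>
      (have e := congrArg Subtype.val h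
       have e0 := congrArg Fin.val (congrFun e 0)
       have e1 := congrArg Fin.val (congrFun e 1)
       have e2 := congrArg Fin.val (congrFun e 2)
       simp only [Matrix.cons_val] at e0 e1 e2
       omega)

theorem totalOp_raising_apply_eq_zero {φ : SpinState ι s} {w : ℕ}
    (hw : ∀ m : ι → Fin (2 * s + 1), ∑ μ, (m μ : ℕ) ≠ w → φ m = 0)
    {m : ι → Fin (2 * s + 1)} (hm : ∑ μ, (m μ : ℕ) ≠ w + 1) :
    totalOp ι (spinRaising s) φ m = 0 := by
  rw [totalOp_apply]
  refine sum_eq_zero fun μ _ => ?_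
  rw [siteOp_apply]
  refine sum_eq_zero fun k _ => ?_
  simp only [spinRaising, Matrix.of_apply]
  split_ifs with hk
  · rw [hw, mul_zero]
    intro h
    apply hm
    rw [← h, ← add_sum_erase _ _ (mem_univ μ), ← add_sum_erase (a := μ) _ _ (mem_univ μ),
      Function.update_self, hk, add_right_comm]
    congr 2
    exact sum_congr rfl fun ν hν => by rw [Function.update_of_ne (ne_of_mem_erase hν)]
  · rw [zero_mul]

/-- A dimension count gives a nonzero weight-zero vector whose raised vector has no weight-one
coefficients; coefficients of other weights vanish automatically. `E` extends by zero and `R`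
restricts to weight one. -/
theorem exists_singlet (s : ℕ) : ∃ φ : SpinState (Fin 3) s, φ ≠ 0 ∧ IsSinglet φ := by
  let W₀ := {m : Fin 3 → Fin (2 * s + 1) // ∑ δ, (m δ : ℕ) = 3 * s}
  let W₁ := {m : Fin 3 → Fin (2 * s + 1) // ∑ δ, (m δ : ℕ) = 3 * s + 1}
  let E : (W₀ → ℂ) →ₗ[ℂ] SpinState (Fin 3) s :=
    { toFun := fun f => WithLp.toLp 2 fun m => if h : ∑ δ, (m δ : ℕ) = 3 * s then f ⟨m, h⟩ else 0
      map_add' := fun f g => by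
        ext m; simp only [PiLp.add_apply]; split_ifs <;> simp
      map_smul' := fun c f => by
        ext m; simp only [PiLp.smul_apply, RingHom.id_apply]; split_ifs <;> simp }
  let R : SpinState (Fin 3) s →ₗ[ℂ] (W₁ → ℂ) :=
    { toFun := fun ψ m => ψ m.1
      map_add' := fun _ _ => rfl
      map_smul' := fun _ _ => rfl }
  have hker : LinearMap.ker (R ∘ₗ totalOp (Fin 3) (spinRaising s) ∘ₗ E) ≠ ⊥ := by
    apply LinearMap.ker_ne_bot_of_finrank_lt
    rw [Module.finrank_pi, Module.finrank_pi]
    exact card_weight_one_lt_card_weight_zero s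
  obtain ⟨f, hf, hf0⟩ := (Submodule.ne_bot_iff _).mp hker
  have hE : ∀ m : Fin 3 → Fin (2 * s + 1), ∑ δ, (m δ : ℕ) ≠ 3 * s → E f m = 0 :=
    fun m hm => dif_neg hm
  refine ⟨E f, fun h => hf0 ?_, isSinglet_of_raising (by simpa using hE) ?_⟩
  · ext m
    have : E f m.1 = 0 := by rw [h]; rfl
    exact (dif_pos m.2).symm.trans this
  · ext m
    by_cases hm : ∑ δ, (m δ : ℕ) = 3 * s + 1
    · exact congrFun (LinearMap.mem_ker.mp hf) ⟨m, hm⟩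
    · exact totalOp_raising_apply_eq_zero hE hm

theorem trimerHamiltonian_eq (s : ℕ) (l : ℝ) :
    trimerHamiltonian s l = (l : ℂ) • ∑ a, totalOp (Fin 3) (spinMatrix s a) *
      totalOp (Fin 3) (spinMatrix s a) := by
  simp only [trimerHamiltonian, heisenberg, spinDot, totalOp, Matrix.of_apply, sum_mul_sum,
    smul_sum]
  rw [sum_comm (s := (univ : Finset (Fin 3)))
    (f := fun a μ => ∑ ν, (l : ℂ) • (siteOp μ (spinMatrix s a) * siteOp ν (spinMatrix s a)))]
  exact sum_congr rfl fun μ _ => sum_comm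

/-- Each total spin component is self-adjoint, so its square contributes a squared norm. -/
theorem re_inner_trimerHamiltonian (l : ℝ) (ψ : SpinState (Fin 3) s) :
    (inner ℂ ψ (trimerHamiltonian s l ψ)).re =
      l * ∑ a, ‖totalOp (Fin 3) (spinMatrix s a) ψ‖ ^ 2 := by
  have h : ∀ a, inner ℂ ψ (totalOp (Fin 3) (spinMatrix s a)
      (totalOp (Fin 3) (spinMatrix s a) ψ)) =
        ((‖totalOp (Fin 3) (spinMatrix s a) ψ‖ ^ 2 : ℝ) : ℂ) := by
    intro a
    conv_lhs => rw [← spinMatrix_conjTranspose, ← inner_totalOp_left, spinMatrix_conjTranspose]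
    rw [inner_self_eq_norm_sq_to_K]
    simp
  rw [trimerHamiltonian_eq]
  simp only [LinearMap.smul_apply, LinearMap.sum_apply, Module.End.mul_apply, inner_smul_right,
    inner_sum, h]
  rw [← Complex.ofReal_sum, ← Complex.ofReal_mul, Complex.ofReal_re]

/-- A normalized singlet has energy zero, so the sum of squared norms of a minimizer must vanish. -/
theorem IsGroundState.isSinglet {l : ℝ} (hl : 0 < l) {φ : SpinState (Fin 3) s}
    (h : IsGroundState (trimerHamiltonian s l) φ) : IsSinglet φ := by
  obtain ⟨χ, hχ0, hχ⟩ := exists_singlet s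
  have hn : ‖((‖χ‖⁻¹ : ℝ) : ℂ) • χ‖ = 1 := by
    rw [norm_smul]
    simp [hχ0]
  have hle := h.2 _ hn
  rw [re_inner_trimerHamiltonian, re_inner_trimerHamiltonian] at hle
  simp only [map_smul, hχ _, smul_zero, norm_zero] at hle
  have h0 : ∑ a, ‖totalOp (Fin 3) (spinMatrix s a) φ‖ ^ 2 = 0 := by
    refine le_antisymm ?_ (sum_nonneg fun _ _ => by positivity)
    simp only [ne_eq, OfNat.ofNat_ne_zero, not_false_eq_true, zero_pow, sum_const_zero,
      mul_zero] at hle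
    exact nonpos_of_mul_nonpos_right hle hl
  intro a
  have := (sum_eq_zero_iff_of_nonneg fun _ _ => by positivity).mp h0 a (mem_univ a)
  simpa using this

end Singlet

/-! ### Nonvanishing coefficients of three-spin singlets. -/

section SingletCoefficients

variable {s : ℕ}

/-- A vector annihilated by the raising operator vanishes if its coefficients do wherever one
fixed spin is maximal. -/
theorem eq_zero_of_raising_of_top {ι : Type} [Fintype ι] [DecidableEq ι] {φ : SpinState ι s}
    (hr : totalOp ι (spinRaising s) φ = 0) (p : ι)
    (htop : ∀ m : ι → Fin (2 * s + 1), (m p : ℕ) = 2 * s → φ m = 0) : φ = 0 := by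
  have key : ∀ d : ℕ, ∀ m : ι → Fin (2 * s + 1), (m p : ℕ) + d = 2 * s → φ m = 0 := by
    intro d
    induction d with
    | zero => exact fun m hm => htop m hm
    | succ d ih =>
      intro m hm
      have hup : (m p : ℕ) + 1 < 2 * s + 1 := by omega
      set m' := Function.update m p ⟨m p + 1, hup⟩ with hm'
      have hm'p : (m' p : ℕ) = m p + 1 := by simp [hm']
      have h0 : totalOp ι (spinRaising s) φ m' = 0 := by rw [hr]; rfl
      -- Raising at a site other than `p` only involves coefficients whose entry at `p` is `m p +
      -- 1`; these vanish by induction. The term at `p` isolates `φ m`.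
      rw [totalOp_apply, Fintype.sum_eq_single p, siteOp_raising_apply p φ m' (m p) hm'p] at h0
      · have e := (mul_eq_zero.mp h0).resolve_left (ladder_coeff_ne_zero s (by omega))
        rwa [hm', Function.update_idem, Function.update_eq_self] at e
      · intro μ hμ
        rw [siteOp_apply]
        refine sum_eq_zero fun k _ => ?_
        rw [ih, mul_zero]
        rw [Function.update_of_ne hμ.symm]
        omega
  ext m
  exact key (2 * s - m p) m (by have := (m p).isLt; omega)

theorem univ_eq_triple {p q r : Fin 3} (hpq : p ≠ q) (hpr : p ≠ r) (hqr : q ≠ r) :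
    (univ : Finset (Fin 3)) = {p, q, r} := by
  revert p q r; decide

/-- The basis states of three spins with maximal spin `p`. -/
def topConfig (s : ℕ) (p q : Fin 3) (k : ℕ) : Fin 3 → Fin (2 * s + 1) :=
  -- Only `k ≤ s` is relevant, where neither the truncated subtraction nor the reduction modulo `2s
  -- + 1` has any effect.
  fun δ => if δ = p then Fin.ofNat _ (2 * s) else
    if δ = q then Fin.ofNat _ k else Fin.ofNat _ (s - k)

theorem topConfig_eq {p q r : Fin 3} (hpq : p ≠ q) (hpr : p ≠ r) (hqr : q ≠ r)
    {m : Fin 3 → Fin (2 * s + 1)} (hp : (m p : ℕ) = 2 * s) (hqr' : (m q : ℕ) + m r = s) :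
    m = topConfig s p q (m q) := by
  have hδ : ∀ δ : Fin 3, δ = p ∨ δ = q ∨ δ = r := fun δ => by
    have h : δ ∈ ({p, q, r} : Finset (Fin 3)) := univ_eq_triple hpq hpr hqr ▸ mem_univ δ
    simpa using h
  funext δ
  ext
  rcases hδ δ with rfl | rfl | rfl
  · simp [topConfig, hp]
  · simp [topConfig, hpq.symm]
  · rw [topConfig, if_neg hpr.symm, if_neg hqr.symm, Fin.val_ofNat, Nat.mod_eq_of_lt (by omega)]
    omega

/-- At the configuration with entries `2s, k, s - k - 1` the lowering equation has no term from `p`.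
It is a two-term relation between the coefficients in question, with nonzero ladder factors. -/
theorem topConfig_step {φ : SpinState (Fin 3) s} (h : totalOp (Fin 3) (spinLowering s) φ = 0)
    {p q r : Fin 3} (hpq : p ≠ q) (hpr : p ≠ r) (hqr : q ≠ r) {k : ℕ} (hk : k + 1 ≤ s) :
    φ (topConfig s p q k) = 0 ↔ φ (topConfig s p q (k + 1)) = 0 := by
  have huniv := univ_eq_triple hpq hpr hqr
  let m : Fin 3 → Fin (2 * s + 1) := fun δ => if δ = p then ⟨2 * s, by omega⟩ else
    if δ = q then ⟨k, by omega⟩ else ⟨s - k - 1, by omega⟩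
  have hmp : (m p : ℕ) = 2 * s := by simp [m]
  have hmq : (m q : ℕ) = k := by simp [m, hpq.symm]
  have hmr : (m r : ℕ) = s - k - 1 := by simp [m, hpr.symm, hqr.symm]
  have h0 : totalOp (Fin 3) (spinLowering s) φ m = 0 := by rw [h]; rfl
  rw [totalOp_apply, huniv, sum_insert (by simp [hpq, hpr]), sum_insert (by simp [hqr]),
    sum_singleton, siteOp_lowering_apply_top p φ m hmp,
    siteOp_lowering_apply q φ m ⟨k + 1, by omega⟩ (by simp [hmq]),
    siteOp_lowering_apply r φ m ⟨s - k, by omega⟩ (by simp [hmr]; omega), zero_add,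
    topConfig_eq hpq hpr hqr (m := Function.update m q _)
      (by rw [Function.update_of_ne hpq, hmp])
      (by rw [Function.update_self, Function.update_of_ne hqr.symm, hmr]; simp; omega),
    topConfig_eq hpq hpr hqr (m := Function.update m r _)
      (by rw [Function.update_of_ne hpr, hmp])
      (by rw [Function.update_self, Function.update_of_ne hqr, hmq]; simp; omega),
    Function.update_self, Function.update_of_ne hqr, hmq] at h0
  have hq := ladder_coeff_ne_zero s (k := m q) (by omega)
  have hr := ladder_coeff_ne_zero s (k := m r) (by omega)
  constructor <;> intro hz
  · rw [hz, mul_zero, add_zero] at h0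
    exact (mul_eq_zero.mp h0).resolve_left hq
  · rw [hz, mul_zero, zero_add] at h0
    exact (mul_eq_zero.mp h0).resolve_left hr

/-- The coefficients of a three-spin singlet do not vanish where one of the spins is maximal. -/
theorem IsSinglet.ne_zero_of_top {φ : SpinState (Fin 3) s} (h : IsSinglet φ) (hφ : φ ≠ 0)
    {p q r : Fin 3} (hpq : p ≠ q) (hpr : p ≠ r) (hqr : q ≠ r)
    {m : Fin 3 → Fin (2 * s + 1)} (hp : (m p : ℕ) = 2 * s) (hm : (m q : ℕ) + m r = s) :
    φ m ≠ 0 := by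
  have huniv := univ_eq_triple hpq hpr hqr
  have hiff : ∀ k ≤ s, (φ (topConfig s p q k) = 0 ↔ φ (topConfig s p q 0) = 0) := by
    intro k
    induction k with
    | zero => exact fun _ => Iff.rfl
    | succ k ih =>
      exact fun hk => (topConfig_step h.lowering hpq hpr hqr hk).symm.trans (ih (by omega))
  intro hz
  -- One zero spreads along the recurrence to all weight-zero coefficients with `p` maximal; the
  -- other weights vanish anyway.
  refine hφ (eq_zero_of_raising_of_top h.raising p fun n hn => ?_)
  by_cases hsum : (n q : ℕ) + n r = s
  · rw [topConfig_eq hpq hpr hqr hp hm] at hz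
    rw [topConfig_eq hpq hpr hqr hn hsum]
    exact (hiff _ (by omega)).mpr ((hiff _ (by omega)).mp hz)
  · apply h.eq_zero_of_sum_ne
    rw [huniv, sum_insert (by simp [hpq, hpr]), sum_insert (by simp [hqr]), sum_singleton,
      Fintype.card_fin]
    omega

end SingletCoefficients

/-! ### Scalar products of spins on singlets. -/

section SpinDot

variable {ι : Type} [Fintype ι] [DecidableEq ι] {s : ℕ}

theorem spinDot_self (μ : ι) : spinDot s μ μ = ((s : ℂ) * (s + 1)) • 1 := by
  have h : ∀ a b c : Matrix (Fin (2 * s + 1)) (Fin (2 * s + 1)) ℂ,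
      siteOp (ι := ι) μ (a + b + c) = siteOp μ a + siteOp μ b + siteOp μ c := by
    intro a b c
    rw [siteOp_add, siteOp_add]
  simp only [spinDot, ← siteOp_mul]
  rw [Fin.sum_univ_three, ← h, ← Fin.sum_univ_three (fun a => spinMatrix s a * spinMatrix s a),
    spinMatrix_casimir, siteOp_smul, siteOp_one]

theorem spinDot_comm (μ ν : ι) : spinDot s μ ν = spinDot s ν μ := by
  rcases eq_or_ne μ ν with rfl | h
  · rfl
  · exact sum_congr rfl fun a _ => siteOp_comm h _ _

theorem IsSinglet.sum_spinDot {φ : SpinState ι s} (h : IsSinglet φ) (μ : ι) :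
    ∑ ν, spinDot s μ ν φ = 0 := by
  simp only [spinDot, LinearMap.sum_apply, Module.End.mul_apply]
  rw [sum_comm]
  refine sum_eq_zero fun a _ => ?_
  rw [← map_sum]
  have := h a
  simp only [totalOp, LinearMap.sum_apply] at this
  rw [this, map_zero]

/-- The three identities `𝐬_μ · 𝐒 φ = 0` form an invertible linear system for the three pair
products; this is special to three spins. -/
theorem IsSinglet.spinDot_of_ne {φ : SpinState (Fin 3) s} (h : IsSinglet φ) {δ ε : Fin 3}
    (hδε : δ ≠ ε) : spinDot s δ ε φ = (-((s : ℂ) * (s + 1)) / 2) • φ := by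
  have h0 := h.sum_spinDot 0
  have h1 := h.sum_spinDot 1
  have h2 := h.sum_spinDot 2
  simp only [Fin.sum_univ_three, spinDot_self, LinearMap.smul_apply, Module.End.one_apply,
    spinDot_comm (1 : Fin 3) 0, spinDot_comm (2 : Fin 3) 0, spinDot_comm (2 : Fin 3) 1] at h0 h1 h2
  have e01 : spinDot s (0 : Fin 3) 1 φ = (-((s : ℂ) * (s + 1)) / 2) • φ := by
    linear_combination (norm := module) (1 / 2 : ℂ) • h0 + (1 / 2 : ℂ) • h1 - (1 / 2 : ℂ) • h2
  have e02 : spinDot s (0 : Fin 3) 2 φ = (-((s : ℂ) * (s + 1)) / 2) • φ := by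
    linear_combination (norm := module) (1 / 2 : ℂ) • h0 - (1 / 2 : ℂ) • h1 + (1 / 2 : ℂ) • h2
  have e12 : spinDot s (1 : Fin 3) 2 φ = (-((s : ℂ) * (s + 1)) / 2) • φ := by
    linear_combination (norm := module) (1 / 2 : ℂ) • h1 - (1 / 2 : ℂ) • h0 + (1 / 2 : ℂ) • h2
  fin_cases δ <;> fin_cases ε <;>
    first
    | exact absurd rfl hδε
    | assumption
    | (rw [spinDot_comm]; assumption)

end SpinDot

/-! ### Spin operators on products of trimer states. -/

section TrimerProduct

variable {N s : ℕ}

theorem trimerProduct_apply (φ : Fin N → SpinState (Fin 3) s)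
    (m : Fin N × Fin 3 → Fin (2 * s + 1)) :
    trimerProduct φ m = ∏ i, φ i fun δ => m (i, δ) := rfl

theorem trimerProduct_update_apply (φ : Fin N → SpinState (Fin 3) s) (i : Fin N)
    (χ : SpinState (Fin 3) s) (m : Fin N × Fin 3 → Fin (2 * s + 1)) :
    trimerProduct (Function.update φ i χ) m =
      χ (fun δ => m (i, δ)) * ∏ j ∈ univ.erase i, φ j fun δ => m (j, δ) := by
  rw [trimerProduct_apply, ← mul_prod_erase _ _ (mem_univ i), Function.update_self]
  congr 1
  exact prod_congr rfl fun j hj => by rw [Function.update_of_ne (ne_of_mem_erase hj)]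

theorem trimerProduct_update_add (φ : Fin N → SpinState (Fin 3) s) (i : Fin N)
    (χ ψ : SpinState (Fin 3) s) :
    trimerProduct (Function.update φ i (χ + ψ)) =
      trimerProduct (Function.update φ i χ) + trimerProduct (Function.update φ i ψ) := by
  ext m
  simp [trimerProduct_update_apply, add_mul]

theorem trimerProduct_update_smul (φ : Fin N → SpinState (Fin 3) s) (i : Fin N)
    (c : ℂ) (χ : SpinState (Fin 3) s) :
    trimerProduct (Function.update φ i (c • χ)) = c • trimerProduct (Function.update φ i χ) := by
  ext m
  simp [trimerProduct_update_apply, mul_assoc]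

/-- The product state as a linear function of the factor at the trimer `i`. -/
noncomputable def trimerProductUpdate (φ : Fin N → SpinState (Fin 3) s) (i : Fin N) :
    SpinState (Fin 3) s →ₗ[ℂ] SpinState (Fin N × Fin 3) s where
  toFun χ := trimerProduct (Function.update φ i χ)
  map_add' := trimerProduct_update_add φ i
  map_smul' := trimerProduct_update_smul φ i

theorem trimerProductUpdate_self (φ : Fin N → SpinState (Fin 3) s) (i : Fin N) :
    trimerProductUpdate φ i (φ i) = trimerProduct φ := by
  simp [trimerProductUpdate]

theorem siteOp_trimerProductUpdate (φ : Fin N → SpinState (Fin 3) s) (i : Fin N) (δ : Fin 3)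
    (A : Matrix (Fin (2 * s + 1)) (Fin (2 * s + 1)) ℂ) (χ : SpinState (Fin 3) s) :
    siteOp (i, δ) A (trimerProductUpdate φ i χ) = trimerProductUpdate φ i (siteOp δ A χ) := by
  ext m
  simp only [trimerProductUpdate, LinearMap.coe_mk, AddHom.coe_mk, siteOp_apply,
    trimerProduct_update_apply, sum_mul, mul_assoc]
  refine sum_congr rfl fun k _ => ?_
  congr 2
  · refine congrArg χ.ofLp (funext fun ε => ?_)
    by_cases h : ε = δ <;> simp [h]
  · refine prod_congr rfl fun j hj => ?_
    refine congrArg (φ j).ofLp (funext fun ε => ?_)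
    simp [ne_of_mem_erase hj]

theorem spinDot_trimerProduct (φ : Fin N → SpinState (Fin 3) s) (i : Fin N) (δ ε : Fin 3) :
    spinDot s (i, δ) (i, ε) (trimerProduct φ) = trimerProductUpdate φ i (spinDot s δ ε (φ i)) := by
  rw [← trimerProductUpdate_self φ i]
  simp only [spinDot, LinearMap.sum_apply, Module.End.mul_apply, siteOp_trimerProductUpdate,
    map_sum]

theorem spinDot_trimerProduct_of_isSinglet {φ : Fin N → SpinState (Fin 3) s}
    (hφ : ∀ i, IsSinglet (φ i)) (i : Fin N) {δ ε : Fin 3} (h : δ ≠ ε) :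
    spinDot s (i, δ) (i, ε) (trimerProduct φ) =
      (-((s : ℂ) * (s + 1)) / 2) • trimerProduct φ := by
  rw [spinDot_trimerProduct, (hφ i).spinDot_of_ne h, map_smul, trimerProductUpdate_self]

theorem sum_siteOp_trimerProduct {φ : Fin N → SpinState (Fin 3) s}
    (hφ : ∀ i, IsSinglet (φ i)) (i : Fin N) (a : Fin 3) :
    ∑ δ, siteOp (i, δ) (spinMatrix s a) (trimerProduct φ) = 0 := by
  rw [← trimerProductUpdate_self φ i]
  simp only [siteOp_trimerProductUpdate, ← map_sum]
  have := hφ i a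
  simp only [totalOp, LinearMap.sum_apply] at this
  rw [this, map_zero]

theorem trimerProduct_ne_zero {φ : Fin N → SpinState (Fin 3) s} (hφ : ∀ i, φ i ≠ 0) :
    trimerProduct φ ≠ 0 := by
  have h : ∀ i, ∃ m, φ i m ≠ 0 := by
    intro i
    by_contra! hc
    exact hφ i (PiLp.ext hc)
  choose m hm using h
  intro h0
  have : trimerProduct φ (fun μ => m μ.1 μ.2) = 0 := by rw [h0]; rfl
  rw [trimerProduct_apply] at this
  exact prod_ne_zero_iff.mpr (fun i _ => hm i) this

/-- The total spin of trimer `i` acts first and kills the product, even when `μ` lies in the same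
trimer. -/
theorem sum_spinDot_left {φ : Fin N → SpinState (Fin 3) s}
    (hφ : ∀ i, IsSinglet (φ i)) (i : Fin N) (μ : Fin N × Fin 3) :
    ∑ δ, spinDot s μ (i, δ) (trimerProduct φ) = 0 := by
  simp only [spinDot, LinearMap.sum_apply, Module.End.mul_apply]
  rw [sum_comm]
  exact sum_eq_zero fun a _ => by rw [← map_sum, sum_siteOp_trimerProduct hφ, map_zero]

end TrimerProduct

/-! ### The balance equations: orthogonality, sufficiency and necessity. -/

section Balance

variable {N s : ℕ}

/-- A zero-sum matrix is determined by its lower right `2 × 2` block, so four checkerboard matrices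
span the space; pairing with each of them gives one balance equation. -/
theorem balanced_iff_orthogonal (J : Matrix (Fin N × Fin 3) (Fin N × Fin 3) ℝ) (i j : Fin N) :
    Balanced J i j ↔ ∀ D ∈ zeroSumMatrices,
      Matrix.trace ((interBlock J i j).transpose * D) = 0 := by
  have htr : ∀ D : Matrix (Fin 3) (Fin 3) ℝ, Matrix.trace ((interBlock J i j).transpose * D) =
      ∑ b, ∑ a, J (i, a) (j, b) * D a b := fun D => by
    simp [Matrix.trace, Matrix.mul_apply, interBlock]
  simp only [htr, Fin.sum_univ_three]
  constructor
  · rintro ⟨h11, h12, h21, h22⟩ D ⟨hr, hc⟩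
    simp only [Fin.sum_univ_three] at hr hc
    linear_combination D 1 1 * h11 + D 1 2 * h12 + D 2 1 * h21 + D 2 2 * h22 +
      J (i, 0) (j, 0) * (hc 0 - hr 1 - hr 2) + J (i, 1) (j, 0) * hr 1 + J (i, 2) (j, 0) * hr 2 +
      J (i, 0) (j, 1) * hc 1 + J (i, 0) (j, 2) * hc 2
  · intro h
    have mem : ∀ D : Matrix (Fin 3) (Fin 3) ℝ, (∀ a, D a 0 + D a 1 + D a 2 = 0) →
        (∀ b, D 0 b + D 1 b + D 2 b = 0) → D ∈ zeroSumMatrices := fun D hr hc =>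
      ⟨fun a => by rw [Fin.sum_univ_three, hr], fun b => by rw [Fin.sum_univ_three, hc]⟩
    have h11 := h !![1, -1, 0; -1, 1, 0; 0, 0, 0] (mem _ (fun a => by fin_cases a <;> simp)
      (fun a => by fin_cases a <;> simp))
    have h12 := h !![1, 0, -1; -1, 0, 1; 0, 0, 0] (mem _ (fun a => by fin_cases a <;> simp)
      (fun a => by fin_cases a <;> simp))
    have h21 := h !![1, -1, 0; 0, 0, 0; -1, 1, 0] (mem _ (fun a => by fin_cases a <;> simp)
      (fun a => by fin_cases a <;> simp))
    have h22 := h !![1, 0, -1; 0, 0, 0; -1, 0, 1] (mem _ (fun a => by fin_cases a <;> simp)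
      (fun a => by fin_cases a <;> simp))
    simp at h11 h12 h21 h22
    exact ⟨by linarith, by linarith, by linarith, by linarith⟩

/-- The additive splitting of the block into a function of `δ` and a function of `ε`, normalized at
index `0`. -/
theorem Balanced.eq_add {J : Matrix (Fin N × Fin 3) (Fin N × Fin 3) ℝ} {i j : Fin N}
    (h : Balanced J i j) (δ ε : Fin 3) :
    J (i, δ) (j, ε) = J (i, δ) (j, 0) + (J (i, 0) (j, ε) - J (i, 0) (j, 0)) := by
  obtain ⟨h11, h12, h21, h22⟩ := h
  fin_cases δ <;> fin_cases ε <;> simp <;> linarith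

theorem Balanced.symm {J : Matrix (Fin N × Fin 3) (Fin N × Fin 3) ℝ}
    (hJ : ∀ μ ν, J μ ν = J ν μ) {i j : Fin N} (h : Balanced J i j) : Balanced J j i := by
  obtain ⟨h11, h12, h21, h22⟩ := h
  simp only [Balanced, fun δ ε => hJ (j, δ) (i, ε)]
  exact ⟨by linarith, by linarith, by linarith, by linarith⟩

/-- The part of the Hamiltonian that couples the trimers `i` and `j`. -/
noncomputable def couplingTerm (s : ℕ) (J : Matrix (Fin N × Fin 3) (Fin N × Fin 3) ℝ)
    (i j : Fin N) : Module.End ℂ (SpinState (Fin N × Fin 3) s) :=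
  ∑ δ, ∑ ε, ((J (i, δ) (j, ε) : ℝ) : ℂ) • spinDot s (i, δ) (j, ε)

theorem heisenberg_eq_sum_couplingTerm (J : Matrix (Fin N × Fin 3) (Fin N × Fin 3) ℝ) :
    heisenberg s J = ∑ i, ∑ j, couplingTerm s J i j := by
  simp only [heisenberg, couplingTerm, Fintype.sum_prod_type]
  exact sum_congr rfl fun i _ => sum_comm

theorem couplingTerm_self {J : Matrix (Fin N × Fin 3) (Fin N × Fin 3) ℝ}
    (hJ : ∀ μ, J μ μ = 0) {φ : Fin N → SpinState (Fin 3) s} (hφ : ∀ i, IsSinglet (φ i))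
    (i : Fin N) : couplingTerm s J i i (trimerProduct φ) =
      (∑ δ, ∑ ε, (J (i, δ) (i, ε) : ℂ) * (-((s : ℂ) * (s + 1)) / 2)) • trimerProduct φ := by
  simp only [couplingTerm, LinearMap.sum_apply, LinearMap.smul_apply, sum_smul, mul_smul]
  refine sum_congr rfl fun δ _ => sum_congr rfl fun ε _ => ?_
  rcases eq_or_ne δ ε with rfl | h
  -- The scalar written for `δ = ε` is not the true one, but its coupling is zero.
  · simp [hJ]
  · rw [spinDot_trimerProduct_of_isSinglet hφ i h]

theorem couplingTerm_eq_zero_of_balanced {J : Matrix (Fin N × Fin 3) (Fin N × Fin 3) ℝ}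
    {φ : Fin N → SpinState (Fin 3) s} (hφ : ∀ i, IsSinglet (φ i))
    {i j : Fin N} (h : Balanced J i j) : couplingTerm s J i j (trimerProduct φ) = 0 := by
  simp only [couplingTerm, LinearMap.sum_apply, LinearMap.smul_apply]
  -- The factors of the second summand are swapped so that summing over `δ` makes the total spin of
  -- trimer `i` act first.
  have e : ∀ δ ε, (J (i, δ) (j, ε) : ℂ) • spinDot s (i, δ) (j, ε) (trimerProduct φ) =
      (J (i, δ) (j, 0) : ℂ) • spinDot s (i, δ) (j, ε) (trimerProduct φ) +
      ((J (i, 0) (j, ε) - J (i, 0) (j, 0) : ℝ) : ℂ) •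
        spinDot s (j, ε) (i, δ) (trimerProduct φ) := by
    intro δ ε
    rw [spinDot_comm (j, ε), ← add_smul, ← Complex.ofReal_add, ← h.eq_add]
  simp only [e, sum_add_distrib]
  rw [sum_comm (f := fun δ ε => ((J (i, 0) (j, ε) - J (i, 0) (j, 0) : ℝ) : ℂ) •
        spinDot s (j, ε) (i, δ) (trimerProduct φ))]
  simp only [← smul_sum, sum_spinDot_left hφ, smul_zero, sum_const_zero, add_zero]

theorem isEigenstate_of_balanced {J : Matrix (Fin N × Fin 3) (Fin N × Fin 3) ℝ}
    (hJsymm : ∀ μ ν, J μ ν = J ν μ) (hJdiag : ∀ μ, J μ μ = 0)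
    {φ : Fin N → SpinState (Fin 3) s} (hφ : ∀ i, IsSinglet (φ i)) (hφ0 : ∀ i, φ i ≠ 0)
    (h : ∀ i j : Fin N, i < j → Balanced J i j) :
    IsEigenstate (heisenberg s J) (trimerProduct φ) := by
  refine ⟨∑ i, ∑ δ, ∑ ε, (J (i, δ) (i, ε) : ℂ) * (-((s : ℂ) * (s + 1)) / 2),
    Module.End.mem_eigenspace_iff.mpr ?_, trimerProduct_ne_zero hφ0⟩
  rw [heisenberg_eq_sum_couplingTerm, LinearMap.sum_apply, sum_smul]
  refine sum_congr rfl fun i _ => ?_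
  rw [LinearMap.sum_apply, Fintype.sum_eq_single i, couplingTerm_self hJdiag hφ]
  intro j hj
  apply couplingTerm_eq_zero_of_balanced hφ
  rcases lt_or_gt_of_ne hj with hlt | hlt
  · exact (h j i hlt).symm hJsymm
  · exact h i j hlt

/-- On basis states in which every trimer has weight zero, only the diagonal entries of an operator
at a single site contribute. -/
theorem siteOp_siteOp_trimerProduct_apply {φ : Fin N → SpinState (Fin 3) s}
    (hφ : ∀ i, IsSinglet (φ i)) {i j : Fin N} (hij : i ≠ j) (δ ε : Fin 3)
    (A B : Matrix (Fin (2 * s + 1)) (Fin (2 * s + 1)) ℂ)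
    {m : Fin N × Fin 3 → Fin (2 * s + 1)} (hm : ∀ i, ∑ δ, (m (i, δ) : ℕ) = 3 * s) :
    siteOp (i, δ) A (siteOp (j, ε) B (trimerProduct φ)) m =
      A (m (i, δ)) (m (i, δ)) * (B (m (j, ε)) (m (j, ε)) * trimerProduct φ m) := by
  have vanish : ∀ (n : Fin N × Fin 3 → Fin (2 * s + 1)) (i : Fin N),
      ∑ δ, (n (i, δ) : ℕ) ≠ 3 * s → trimerProduct φ n = 0 := fun n i hn =>
    prod_eq_zero (mem_univ i) ((hφ i).eq_zero_of_sum_ne (by simpa using hn))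
  have hupd : ∀ (n : Fin N × Fin 3 → Fin (2 * s + 1)) (i : Fin N) (δ : Fin 3)
      (k : Fin (2 * s + 1)), ∑ δ, (n (i, δ) : ℕ) = 3 * s → k ≠ n (i, δ) →
      ∑ δ', (Function.update n (i, δ) k (i, δ') : ℕ) ≠ 3 * s := by
    intro n i δ k hn hk hsum
    rw [← add_sum_erase _ _ (mem_univ δ)] at hn hsum
    have : ∑ x ∈ univ.erase δ, (Function.update n (i, δ) k (i, x) : ℕ) =
        ∑ x ∈ univ.erase δ, (n (i, x) : ℕ) :=
      sum_congr rfl fun x hx => by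
        rw [Function.update_of_ne (by simpa using ne_of_mem_erase hx)]
    rw [this, Function.update_self] at hsum
    exact hk (Fin.ext (by omega))
  rw [siteOp_apply, Fintype.sum_eq_single (m (i, δ)), Function.update_eq_self, siteOp_apply,
    Fintype.sum_eq_single (m (j, ε)), Function.update_eq_self]
  · intro k hk
    rw [vanish _ j (hupd m j ε k (hm j) hk), mul_zero]
  · intro k hk
    rw [siteOp_apply, sum_eq_zero, mul_zero]
    intro l _
    rw [vanish _ i, mul_zero]
    -- The operator at `(j, ε)` does not touch trimer `i`, so it cannot restore the weight lost
    -- there.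
    have hne : ∀ δ', ((i, δ') : Fin N × Fin 3) ≠ (j, ε) := fun δ' h => hij (congrArg Prod.fst h)
    simp only [Function.update_of_ne (hne _)]
    exact hupd m i δ k (hm i) hk

theorem couplingTerm_trimerProduct_apply (J : Matrix (Fin N × Fin 3) (Fin N × Fin 3) ℝ)
    {φ : Fin N → SpinState (Fin 3) s} (hφ : ∀ i, IsSinglet (φ i)) {i j : Fin N} (hij : i ≠ j)
    {m : Fin N × Fin 3 → Fin (2 * s + 1)} (hm : ∀ i, ∑ δ, (m (i, δ) : ℕ) = 3 * s) :
    couplingTerm s J i j (trimerProduct φ) m =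
      ((∑ δ, ∑ ε, J (i, δ) (j, ε) * (magneticNumber s (m (i, δ)) *
        magneticNumber s (m (j, ε))) : ℝ) : ℂ) * trimerProduct φ m := by
  have hdot : ∀ δ ε, (spinDot s (i, δ) (j, ε) (trimerProduct φ)).ofLp m =
      magneticNumber s (m (i, δ)) * magneticNumber s (m (j, ε)) * trimerProduct φ m := by
    intro δ ε
    simp only [spinDot, LinearMap.sum_apply, Module.End.mul_apply, WithLp.ofLp_sum,
      Finset.sum_apply]
    -- The first two spin matrices have zero diagonal, so only the third component contributes.
    rw [Fintype.sum_eq_single 2, siteOp_siteOp_trimerProduct_apply hφ hij _ _ _ _ hm]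
    · simp only [spinMatrix_apply_self, if_true, mul_assoc]
    · intro a ha
      rw [siteOp_siteOp_trimerProduct_apply hφ hij _ _ _ _ hm, spinMatrix_apply_self, if_neg ha,
        zero_mul]
  simp only [couplingTerm, LinearMap.sum_apply, LinearMap.smul_apply, WithLp.ofLp_sum,
    Finset.sum_apply, PiLp.smul_apply, smul_eq_mul, hdot, Complex.ofReal_sum, Complex.ofReal_mul,
    sum_mul, mul_assoc]

/-- The classical energy of the couplings between different trimers, as a bilinear form. -/
noncomputable def interForm (J : Matrix (Fin N × Fin 3) (Fin N × Fin 3) ℝ)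
    (x y : Fin N → Fin 3 → ℝ) : ℝ :=
  ∑ i, ∑ j, if i = j then 0 else ∑ δ, ∑ ε, J (i, δ) (j, ε) * (x i δ * y j ε)

theorem interForm_add_left (J : Matrix (Fin N × Fin 3) (Fin N × Fin 3) ℝ)
    (x y z : Fin N → Fin 3 → ℝ) : interForm J (x + y) z = interForm J x z + interForm J y z := by
  simp only [interForm, ← sum_add_distrib]
  refine sum_congr rfl fun i _ => sum_congr rfl fun j _ => ?_
  split_ifs
  · simp
  · simp only [← sum_add_distrib, Pi.add_apply]
    exact sum_congr rfl fun _ _ => sum_congr rfl fun _ _ => by ring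

theorem interForm_comm {J : Matrix (Fin N × Fin 3) (Fin N × Fin 3) ℝ}
    (hJ : ∀ μ ν, J μ ν = J ν μ) (x y : Fin N → Fin 3 → ℝ) : interForm J x y = interForm J y x := by
  simp only [interForm]
  rw [sum_comm]
  refine sum_congr rfl fun i _ => sum_congr rfl fun j _ => ?_
  simp only [eq_comm (a := j)]
  split_ifs
  · rfl
  · rw [sum_comm]
    exact sum_congr rfl fun δ _ => sum_congr rfl fun ε _ => by rw [hJ]; ring

theorem interForm_single (J : Matrix (Fin N × Fin 3) (Fin N × Fin 3) ℝ) {i j : Fin N} (hij : i ≠ j)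
    (u v : Fin 3 → ℝ) : interForm J (Pi.single i u) (Pi.single j v) =
      ∑ δ, ∑ ε, J (i, δ) (j, ε) * (u δ * v ε) := by
  rw [interForm, Fintype.sum_eq_single i, Fintype.sum_eq_single j]
  · simp [hij]
  · intro k hk
    simp [Pi.single_eq_of_ne hk]
  · intro k hk
    simp [Pi.single_eq_of_ne hk]

/-- If the product of singlets is an eigenstate, then the classical energy of the couplings between
different trimers is constant on the weight-zero basis states that occur in it. -/
theorem exists_interForm_eq {J : Matrix (Fin N × Fin 3) (Fin N × Fin 3) ℝ}
    (hJ : ∀ μ, J μ μ = 0) {φ : Fin N → SpinState (Fin 3) s} (hφ : ∀ i, IsSinglet (φ i))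
    (h : IsEigenstate (heisenberg s J) (trimerProduct φ)) :
    ∃ c : ℂ, ∀ m : Fin N → Fin 3 → Fin (2 * s + 1), (∀ i, φ i (m i) ≠ 0) →
      (interForm J (fun i δ => magneticNumber s (m i δ))
        (fun i δ => magneticNumber s (m i δ)) : ℂ) = c := by
  obtain ⟨e, he, -⟩ := h
  -- The constant is the eigenvalue minus the scalar contributed by the couplings inside the
  -- trimers.
  refine ⟨e - ∑ i, ∑ δ, ∑ ε, (J (i, δ) (i, ε) : ℂ) * (-((s : ℂ) * (s + 1)) / 2),
    fun m hm => ?_⟩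
  have hsum : ∀ i, ∑ δ, (m i δ : ℕ) = 3 * s := fun i => by
    by_contra hne
    exact hm i ((hφ i).eq_zero_of_sum_ne (by simpa using hne))
  have hne : trimerProduct φ (fun μ => m μ.1 μ.2) ≠ 0 := by
    rw [trimerProduct_apply]
    exact prod_ne_zero_iff.mpr fun i _ => hm i
  have hE := congrArg (fun ψ => ψ.ofLp fun μ => m μ.1 μ.2) (Module.End.mem_eigenspace_iff.mp he)
  apply mul_right_cancel₀ hne
  simp only [PiLp.smul_apply, smul_eq_mul] at hE
  rw [sub_mul, ← hE, heisenberg_eq_sum_couplingTerm, interForm]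
  simp only [LinearMap.sum_apply, WithLp.ofLp_sum, Finset.sum_apply, sum_mul,
    ← sum_sub_distrib, Complex.ofReal_sum]
  refine sum_congr rfl fun i _ => ?_
  rw [← add_sum_erase _ _ (mem_univ i), ← add_sum_erase (a := i) univ
    (fun j => couplingTerm s J i j (trimerProduct φ) _) (mem_univ i), couplingTerm_self hJ hφ]
  simp only [if_true, PiLp.smul_apply, smul_eq_mul, sum_mul]
  rw [add_sub_right_comm, sub_self, Complex.ofReal_zero, zero_mul]
  congr 1
  refine sum_congr rfl fun j hj => ?_
  rw [if_neg (ne_of_mem_erase hj).symm,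
    couplingTerm_trimerProduct_apply J hφ (ne_of_mem_erase hj).symm hsum]

/-- For a quadratic form `Q` with symmetric bilinear form `B`, `Q(z+u+v) - Q(z+u) - Q(z+v) + Q(z) =
2 B(u,v)`. Here `u` and `v` live on trimers `i` and `j`, and all four configurations lie in the
support because the state is a product. -/
theorem sum_coupling_eq_zero {J : Matrix (Fin N × Fin 3) (Fin N × Fin 3) ℝ}
    (hJsymm : ∀ μ ν, J μ ν = J ν μ) (hJdiag : ∀ μ, J μ μ = 0)
    {φ : Fin N → SpinState (Fin 3) s} (hφ : ∀ i, IsSinglet (φ i)) (hφ0 : ∀ i, φ i ≠ 0)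
    (h : IsEigenstate (heisenberg s J) (trimerProduct φ)) {i j : Fin N} (hij : i ≠ j)
    {x x' y y' : Fin 3 → Fin (2 * s + 1)} (hx : φ i x ≠ 0) (hx' : φ i x' ≠ 0)
    (hy : φ j y ≠ 0) (hy' : φ j y' ≠ 0) :
    ∑ δ, ∑ ε, J (i, δ) (j, ε) * (((x δ : ℝ) - x' δ) * ((y ε : ℝ) - y' ε)) = 0 := by
  obtain ⟨c, hc⟩ := exists_interForm_eq hJdiag hφ h
  have hex : ∀ k, ∃ m, φ k m ≠ 0 := by
    intro k
    by_contra! hk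
    exact hφ0 k (PiLp.ext hk)
  choose w hw using hex
  let M : (Fin 3 → Fin (2 * s + 1)) → (Fin 3 → Fin (2 * s + 1)) → Fin N → Fin 3 →
    Fin (2 * s + 1) := fun a b => Function.update (Function.update w i a) j b
  have hM : ∀ a b, φ i a ≠ 0 → φ j b ≠ 0 → ∀ k, φ k (M a b k) ≠ 0 := by
    intro a b ha hb k
    rcases eq_or_ne k j with rfl | hkj
    · simpa [M] using hb
    · rcases eq_or_ne k i with rfl | hki
      · simpa [M, hkj] using ha
      · simpa [M, hkj, hki] using hw k
  set z : Fin N → Fin 3 → ℝ := fun k δ => magneticNumber s (M x' y' k δ) with hz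
  set u : Fin N → Fin 3 → ℝ := Pi.single i fun δ => (x δ : ℝ) - x' δ with hu
  set v : Fin N → Fin 3 → ℝ := Pi.single j fun δ => (y δ : ℝ) - y' δ with hv
  have expand : ∀ a b : Fin N → Fin 3 → ℝ, interForm J (a + b) (a + b) =
      interForm J a a + 2 * interForm J a b + interForm J b b := by
    intro a b
    rw [interForm_add_left, interForm_comm hJsymm a (a + b), interForm_comm hJsymm b (a + b),
      interForm_add_left, interForm_add_left, interForm_comm hJsymm b a]
    ring
  have hMx : (fun k δ => magneticNumber s (M x y' k δ)) = z + u := by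
    funext k δ
    rcases eq_or_ne k j with rfl | hkj
    · simp [M, hz, hu, hij.symm]
    · rcases eq_or_ne k i with rfl | hki
      · simp [M, hz, hu, hkj, magneticNumber]
      · simp [M, hz, hu, hkj, hki]
  have hMy : (fun k δ => magneticNumber s (M x' y k δ)) = z + v := by
    funext k δ
    rcases eq_or_ne k j with rfl | hkj
    · simp [M, hz, hv, magneticNumber]
    · simp [M, hz, hv, hkj]
  have hMxy : (fun k δ => magneticNumber s (M x y k δ)) = z + u + v := by
    rw [← hMx]
    funext k δ
    rcases eq_or_ne k j with rfl | hkj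
    · simp [M, hv, magneticNumber]
    · simp [M, hv, hkj]
  have c0 := hc _ (hM x' y' hx' hy')
  have cx := hc _ (hM x y' hx hy')
  have cy := hc _ (hM x' y hx' hy)
  have cxy := hc _ (hM x y hx hy)
  rw [hMx, ← c0] at cx
  rw [hMy, ← c0] at cy
  rw [hMxy, ← c0] at cxy
  have cx' := Complex.ofReal_injective cx
  have cy' := Complex.ofReal_injective cy
  have cxy' := Complex.ofReal_injective cxy
  rw [expand] at cx' cy'
  rw [expand, expand, interForm_add_left] at cxy'
  rw [← interForm_single J hij]
  linarith

/-- The supported pairs differ by `s(0,-1,1)` and `s(-1,0,1)`, a basis of the zero-sum vectors when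
`s ≠ 0`. Their four tensor products give the balance equations based at index `2`, which are
linearly equivalent to those based at `0`. -/
theorem balanced_of_isEigenstate (hs : 1 ≤ s) {J : Matrix (Fin N × Fin 3) (Fin N × Fin 3) ℝ}
    (hJsymm : ∀ μ ν, J μ ν = J ν μ) (hJdiag : ∀ μ, J μ μ = 0)
    {φ : Fin N → SpinState (Fin 3) s} (hφ : ∀ i, IsSinglet (φ i)) (hφ0 : ∀ i, φ i ≠ 0)
    (h : IsEigenstate (heisenberg s J) (trimerProduct φ)) {i j : Fin N} (hij : i ≠ j) :
    Balanced J i j := by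
  let top : Fin (2 * s + 1) := ⟨2 * s, by omega⟩
  let mid : Fin (2 * s + 1) := ⟨s, by omega⟩
  have a : ∀ k, φ k ![top, 0, mid] ≠ 0 := fun k =>
    (hφ k).ne_zero_of_top (hφ0 k) (p := 0) (q := 1) (r := 2) (by decide) (by decide) (by decide)
      (by simp [top]) (by simp [mid])
  have a' : ∀ k, φ k ![top, mid, 0] ≠ 0 := fun k =>
    (hφ k).ne_zero_of_top (hφ0 k) (p := 0) (q := 1) (r := 2) (by decide) (by decide) (by decide)
      (by simp [top]) (by simp [mid])
  have b : ∀ k, φ k ![0, top, mid] ≠ 0 := fun k =>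
    (hφ k).ne_zero_of_top (hφ0 k) (p := 1) (q := 0) (r := 2) (by decide) (by decide) (by decide)
      (by simp [top]) (by simp [mid])
  have b' : ∀ k, φ k ![mid, top, 0] ≠ 0 := fun k =>
    (hφ k).ne_zero_of_top (hφ0 k) (p := 1) (q := 0) (r := 2) (by decide) (by decide) (by decide)
      (by simp [top]) (by simp [mid])
  have key := fun {x x' y y'} => sum_coupling_eq_zero hJsymm hJdiag hφ hφ0 h hij
    (x := x) (x' := x') (y := y) (y' := y')
  have k11 := key (a i) (a' i) (a j) (a' j)
  have k12 := key (a i) (a' i) (b j) (b' j)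
  have k21 := key (b i) (b' i) (a j) (a' j)
  have k22 := key (b i) (b' i) (b j) (b' j)
  simp only [Fin.sum_univ_three, Matrix.cons_val, top, mid, Fin.val_zero, Nat.cast_zero, sub_self,
    zero_sub, sub_zero, mul_zero, zero_mul, add_zero, zero_add] at k11 k12 k21 k22
  have hs2 : (s : ℝ) * s ≠ 0 := by
    have : (s : ℝ) ≠ 0 := by exact_mod_cast (by omega : s ≠ 0)
    exact mul_ne_zero this this
  have q11 : J (i, 1) (j, 1) - J (i, 1) (j, 2) - J (i, 2) (j, 1) + J (i, 2) (j, 2) = 0 :=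
    mul_left_cancel₀ hs2 (by linear_combination k11)
  have q12 : J (i, 1) (j, 0) - J (i, 1) (j, 2) - J (i, 2) (j, 0) + J (i, 2) (j, 2) = 0 :=
    mul_left_cancel₀ hs2 (by linear_combination k12)
  have q21 : J (i, 0) (j, 1) - J (i, 0) (j, 2) - J (i, 2) (j, 1) + J (i, 2) (j, 2) = 0 :=
    mul_left_cancel₀ hs2 (by linear_combination k21)
  have q22 : J (i, 0) (j, 0) - J (i, 0) (j, 2) - J (i, 2) (j, 0) + J (i, 2) (j, 2) = 0 :=
    mul_left_cancel₀ hs2 (by linear_combination k22)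
  exact ⟨by linarith, by linarith, by linarith, by linarith⟩

end Balance

end SpinTrimer

theorem mainTheorem3 (s : ℕ) (hs : 1 ≤ s) (N : ℕ)
    (J : Matrix (Fin N × Fin 3) (Fin N × Fin 3) ℝ)
    (hJsymm : ∀ μ ν, J μ ν = J ν μ) (hJdiag : ∀ μ, J μ μ = 0) :
    (∀ (l : Fin N → ℝ) (φ : Fin N → SpinTrimer.SpinState (Fin 3) s),
      (∀ i, 0 < l i) →
      (∀ i, SpinTrimer.IsGroundState (SpinTrimer.trimerHamiltonian s (l i)) (φ i)) →
      (SpinTrimer.IsEigenstate (SpinTrimer.heisenberg s J) (SpinTrimer.trimerProduct φ) ↔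
        ∀ i j : Fin N, i < j → SpinTrimer.Balanced J i j)) ∧
    (∀ i j : Fin N, i < j →
      (SpinTrimer.Balanced J i j ↔
        ∀ D ∈ SpinTrimer.zeroSumMatrices,
          Matrix.trace ((SpinTrimer.interBlock J i j).transpose * D) = 0)) := by
  refine ⟨fun l φ hl hφ => ?_, fun i j _ => SpinTrimer.balanced_iff_orthogonal J i j⟩
  have hsing : ∀ i, SpinTrimer.IsSinglet (φ i) := fun i => (hφ i).isSinglet (hl i)
  have hne : ∀ i, φ i ≠ 0 := fun i h0 => by
    have h1 := (hφ i).1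
    rw [h0, norm_zero] at h1
    exact zero_ne_one h1
  exact ⟨fun h i j hij =>
      SpinTrimer.balanced_of_isEigenstate hs hJsymm hJdiag hsing hne h hij.ne,
    SpinTrimer.isEigenstate_of_balanced hJsymm hJdiag hsing hne⟩
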